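/- Let $d\ge 2$, let $X=\{1,\dots,d\}$, and let $T$ be the $d$-regular rooted tree whose vertices are the finite words over $X$, the root being the empty word and the children of a word $v$ being the words $vx$ with $x\in X$. Let $\operatorname{Aut}(T)$ be the group of automorphisms of $T$ fixing the root, with the topology in which the stabilizers $\operatorname{St}(n)$ of the levels $n\in\mathbb N$ (the pointwise stabilizers of the sets of words of length $n$) form a base of neighbourhoods of the identity. For $g\in\operatorname{Aut}(T)$ and a vertex $v$ let $g|_v^1\in\operatorname{Sym}(d)$ be the permutation determined by $g(vx)=g(v)\,g|_v^1(x)$ for all $x\in X$. Let $1\neq\mathcal Q\lhd\mathcal P\le\operatorname{Sym}(d)$, and let $$G_{\mathcal Q}^{\mathcal P}=\{g\in\operatorname{Aut}(T): g|_v^1\in\mathcal P \text{ and } (g|_v^1)(g|_w^1)^{-1}\in\mathcal Q \text{ for all vertices } v,w \text{ of } T\},$$ a closed subgroup of $\operatorname{Aut}(T)$, with the subspace topology. Call it topologically finitely generated if it contains a finitely generated dense subgroup, and let $\mathcal Q'$ denote the commutator subgroup of $\mathcal Q$. 1. If $\mathcal Q\neq\mathcal Q'$, or if there is $x\in X$ with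 $q(x)=x$ for all $q\in\mathcal Q$, then $G_{\mathcal Q}^{\mathcal P}$ is not topologically finitely generated. 2. If $\mathcal Q$ is transitive on $X$, then $G_{\mathcal Q}^{\mathcal P}$ is topologically finitely generated if and only if $\mathcal Q=\mathcal Q'$. -/

import Mathlib

/-- The `d`-regular rooted tree, with words over `{0, …, d-1}` as vertices and the empty word as
root: the children of a word `v` are the words `v x` with `x` a letter. -/
def regTree (d : ℕ) : SimpleGraph (List (Fin d)) where
  Adj v w := (∃ x, w = v ++ [x]) ∨ (∃ x, v = w ++ [x])
  symm := ⟨fun _ _ h => h.symm⟩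
  loopless := ⟨fun v h => by rcases h with ⟨x, h⟩ | ⟨x, h⟩ <;> simpa using congrArg List.length h⟩

/-- `Aut(T)`: the bijections of the vertex set that preserve adjacency and fix the root.
The product is composition, `(g * h) v = g (h v)`. -/
def AutT (d : ℕ) : Subgroup (regTree d ≃g regTree d) where
  carrier := {g | g [] = []}
  one_mem' := rfl
  mul_mem' := by
    intro g h hg hh
    change g (h []) = []
    rw [show h [] = [] from hh]
    exact hg
  inv_mem' := by
    intro g hg
    change g.symm [] = []
    rw [RelIso.symm_apply_eq]
    exact (show g [] = [] from hg).symm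

namespace AutT

variable {d : ℕ}

theorem root (g : AutT d) : g.1 [] = [] := g.2

theorem mul_app (g h : AutT d) (v : List (Fin d)) : (g * h).1 v = g.1 (h.1 v) := rfl

theorem inv_app_self (g : AutT d) (v : List (Fin d)) : (g⁻¹).1 (g.1 v) = v :=
  g.1.symm_apply_apply v

theorem app_inv_self (g : AutT d) (v : List (Fin d)) : g.1 ((g⁻¹).1 v) = v :=
  g.1.apply_symm_apply v

/-- A root-preserving automorphism maps the children of `v` to children of `g v`. -/
theorem exists_child (g : AutT d) (v : List (Fin d)) :
    ∀ x, ∃ y, g.1 (v ++ [x]) = g.1 v ++ [y] := by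
  induction v using List.reverseRecOn with
  | nil =>
    intro x
    have h : (regTree d).Adj (g.1 []) (g.1 ([] ++ [x])) :=
      g.1.map_rel_iff.2 (Or.inl ⟨x, rfl⟩)
    rcases h with h | ⟨y, h⟩
    · exact h
    · rw [root] at h
      simpa using congrArg List.length h
  | append_singleton u z ih =>
    intro x
    have h : (regTree d).Adj (g.1 (u ++ [z])) (g.1 (u ++ [z] ++ [x])) :=
      g.1.map_rel_iff.2 (Or.inl ⟨x, rfl⟩)
    rcases h with h | ⟨y, h⟩
    · exact h
    · obtain ⟨t, ht⟩ := ih z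
      rw [ht] at h
      have h2 := g.1.injective (List.append_inj_left' h rfl)
      simpa using congrArg List.length h2

/-- The underlying map of the label of `g` at `v`. -/
noncomputable def labelFun (g : AutT d) (v : List (Fin d)) (x : Fin d) : Fin d :=
  (exists_child g v x).choose

theorem labelFun_spec (g : AutT d) (v : List (Fin d)) (x : Fin d) :
    g.1 (v ++ [x]) = g.1 v ++ [labelFun g v x] :=
  (exists_child g v x).choose_spec

theorem labelFun_injective (g : AutT d) (v : List (Fin d)) :
    Function.Injective (labelFun g v) := by
  intro x y hxy
  have h : g.1 (v ++ [x]) = g.1 (v ++ [y]) := by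
    rw [labelFun_spec, labelFun_spec, hxy]
  simpa using g.1.injective h

/-- The label `g|_v^1` of `g` at the vertex `v`: the permutation of the letters with
`g (v x) = g v (g|_v^1 x)`. -/
noncomputable def label (g : AutT d) (v : List (Fin d)) : Equiv.Perm (Fin d) :=
  Equiv.ofBijective (labelFun g v) (Finite.injective_iff_bijective.1 (labelFun_injective g v))

theorem label_spec (g : AutT d) (v : List (Fin d)) (x : Fin d) :
    g.1 (v ++ [x]) = g.1 v ++ [label g v x] := labelFun_spec g v x

theorem label_eq (g : AutT d) (v : List (Fin d)) (σ : Equiv.Perm (Fin d))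
    (h : ∀ x, g.1 (v ++ [x]) = g.1 v ++ [σ x]) : label g v = σ := by
  ext x
  have h1 := (label_spec g v x).symm.trans (h x)
  simp only [List.append_cancel_left_eq, List.cons.injEq, and_true] at h1
  rw [h1]

theorem label_one (v : List (Fin d)) : label (1 : AutT d) v = 1 :=
  label_eq _ _ _ fun _ => rfl

theorem label_mul (g h : AutT d) (v : List (Fin d)) :
    label (g * h) v = label g (h.1 v) * label h v :=
  label_eq _ _ _ fun x => by
    rw [mul_app, mul_app, label_spec, label_spec]; rfl

theorem label_inv (g : AutT d) (v : List (Fin d)) :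
    label g⁻¹ v = (label g ((g⁻¹).1 v))⁻¹ := by
  have h := label_mul g g⁻¹ v
  rw [mul_inv_cancel, label_one] at h
  exact eq_inv_of_mul_eq_one_right h.symm

theorem length_app (g : AutT d) (v : List (Fin d)) : (g.1 v).length = v.length := by
  induction v using List.reverseRecOn with
  | nil => rw [root]
  | append_singleton u z ih => rw [label_spec]; simp [ih]

/-- The stabilizer `St(n)` of the level `n`. -/
def levelStab (d n : ℕ) : Subgroup (AutT d) where
  carrier := {g | ∀ v : List (Fin d), v.length = n → g.1 v = v}
  one_mem' := fun _ _ => rfl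
  mul_mem' := by
    intro g h hg hh v hv
    rw [mul_app, hh v hv, hg v hv]
  inv_mem' := by
    intro g hg v hv
    have h := inv_app_self g v
    rwa [hg v hv] at h

theorem levelStab_normal (d n : ℕ) : (levelStab d n).Normal where
  conj_mem := by
    intro h hh g v hv
    rw [mul_app, mul_app, hh _ ((length_app _ _).trans hv), app_inv_self]

theorem levelStab_succ_le (d n : ℕ) : levelStab d (n + 1) ≤ levelStab d n := by
  intro g hg v hv
  rcases Nat.eq_zero_or_pos d with rfl | hd
  · have : v = [] := by
      cases v with
      | nil => rfl
      | cons x _ => exact x.elim0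
    rw [this, root]
  · have h := hg (v ++ [⟨0, hd⟩]) (by simp [hv])
    rw [label_spec] at h
    exact List.append_inj_left' h rfl

theorem levelStab_antitone (d : ℕ) : Antitone (levelStab d) :=
  antitone_nat_of_succ_le (levelStab_succ_le d)

/-- The level stabilizers as a base of neighbourhoods of the identity. -/
@[reducible] def levelBasis (d : ℕ) : GroupFilterBasis (AutT d) where
  sets := Set.range fun n => (levelStab d n : Set (AutT d))
  nonempty := Set.range_nonempty _
  inter_sets := by
    rintro _ _ ⟨m, rfl⟩ ⟨n, rfl⟩
    exact ⟨_, ⟨max m n, rfl⟩, Set.subset_inter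
      (levelStab_antitone d (le_max_left m n)) (levelStab_antitone d (le_max_right m n))⟩
  one' := by
    rintro _ ⟨n, rfl⟩
    exact (levelStab d n).one_mem
  mul' := by
    rintro _ ⟨n, rfl⟩
    refine ⟨_, ⟨n, rfl⟩, ?_⟩
    rintro _ ⟨g, hg, h, hh, rfl⟩
    exact (levelStab d n).mul_mem hg hh
  inv' := by
    rintro _ ⟨n, rfl⟩
    exact ⟨_, ⟨n, rfl⟩, fun g hg => (levelStab d n).inv_mem hg⟩
  conj' := by
    rintro g _ ⟨n, rfl⟩
    exact ⟨_, ⟨n, rfl⟩, fun h hh => (levelStab_normal d n).conj_mem h hh g⟩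

/-- The topological group `Aut(T)`, with the level stabilizers as a base of neighbourhoods of the
identity. -/
instance instTopologicalSpace (d : ℕ) : TopologicalSpace (AutT d) := (levelBasis d).topology

instance instIsTopologicalGroup (d : ℕ) : IsTopologicalGroup (AutT d) :=
  (levelBasis d).isTopologicalGroup

end AutT

/-- The group `G_Q^P` of the automorphisms of the `d`-regular rooted tree whose labels all lie in
`P`, and in one and the same coset of `Q`. -/
def GQP {d : ℕ} (Q P : Subgroup (Equiv.Perm (Fin d))) (hN : (Q.subgroupOf P).Normal) :
    Subgroup (AutT d) where
  carrier := {g | (∀ v, AutT.label g v ∈ P) ∧ ∀ v w, AutT.label g v * (AutT.label g w)⁻¹ ∈ Q}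
  one_mem' := by simp [AutT.label_one, Q.one_mem, P.one_mem]
  mul_mem' := by
    rintro g h ⟨hg, hg'⟩ ⟨hh, hh'⟩
    refine ⟨fun v => ?_, fun v w => ?_⟩
    · rw [AutT.label_mul]
      exact P.mul_mem (hg _) (hh _)
    · rw [AutT.label_mul, AutT.label_mul]
      have h1 := hN.conj_mem ⟨AutT.label h v * (AutT.label h w)⁻¹, P.mul_mem (hh v) (P.inv_mem (hh w))⟩
        (hh' v w) ⟨AutT.label g (h.1 v), hg _⟩
      have h2 := Q.mul_mem (show AutT.label g (h.1 v) * (AutT.label h v * (AutT.label h w)⁻¹) *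
        (AutT.label g (h.1 v))⁻¹ ∈ Q from h1) (hg' (h.1 v) (h.1 w))
      convert h2 using 1
      group
  inv_mem' := by
    rintro g ⟨hg, hg'⟩
    refine ⟨fun v => ?_, fun v w => ?_⟩
    · rw [AutT.label_inv]
      exact P.inv_mem (hg _)
    · rw [AutT.label_inv, AutT.label_inv, inv_inv]
      set a := AutT.label g ((g⁻¹).1 v)
      set b := AutT.label g ((g⁻¹).1 w)
      have ha : a ∈ P := hg _
      have hb : b ∈ P := hg _
      have h1 := hN.conj_mem ⟨b * a⁻¹, P.mul_mem hb (P.inv_mem ha)⟩ (hg' _ _) ⟨a⁻¹, P.inv_mem ha⟩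
      have h2 : a⁻¹ * (b * a⁻¹) * (a⁻¹)⁻¹ ∈ Q := h1
      convert h2 using 1
      group

/-- A topological group is topologically finitely generated if it contains a finitely generated
dense subgroup. -/
def TopFG (G : Type*) [Group G] [TopologicalSpace G] : Prop :=
  ∃ H : Subgroup G, H.FG ∧ Dense (H : Set G)

/-!
Let `W` be the infinitely iterated wreath product of `Q`, that is `G_Q^Q`. It is open and of finite
index in `G_Q^P`, so by Schreier's lemma one of the two groups is topologically finitely generated
if and only if the other is.

A topologically finitely generated group has only finitely many homomorphisms with open kernel to a
given finite group. But `W` has infinitely many if `Q` is not perfect, namely the products of the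
labels at the level `n` in the abelianization of `Q`, and also if `Q ≠ 1` fixes a letter `x`, namely
the labels at the fixed vertices `xⁿ` with values in `Q`.

Conversely, any subgroup of `W` that contains the rooted automorphisms from `Q` and is closed under
copying to the subtrees of the first level is dense in `W`. If `Q` is perfect and transitive, some
such subgroup is generated by finitely many rooted and spinal automorphisms and their copies: the
spinal automorphism `s q` carries the label `q` at the vertices `x₀²ⁿ x₁ x₁`, and conjugating `s q`
below `x₀` moves its labels away from those of `s p`, except for the one at `x₁ x₁`. The commutator
of `s p` with this conjugate is thus the copy of `⁅p, q⁆` at `x₁ x₁`, and these commutators generate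
`Q`.
-/

section FiniteGeneration

theorem finite_monoidHom_of_fg (M A : Type*) [Monoid M] [Monoid.FG M] [Monoid A] [Finite A] :
    Finite (M →* A) := by
  obtain ⟨S, hS, hfin⟩ := Monoid.fg_iff.1 ‹Monoid.FG M›
  have : Finite S := hfin
  exact .of_injective (fun φ (s : S) => φ s) fun φ ψ h =>
    MonoidHom.eq_of_eqOn_denseM hS fun s hs => congrFun h ⟨s, hs⟩

theorem fg_map {G N : Type*} [Group G] [Group N] (f : N →* G) {H : Subgroup N} (hH : H.FG) :
    (H.map f).FG := by
  rw [Subgroup.fg_iff_submonoid_fg] at hH ⊢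
  exact hH.map f

theorem fg_map_iff_of_injective {G N : Type*} [Group G] [Group N] {f : N →* G}
    (hf : Function.Injective f) {H : Subgroup N} : (H.map f).FG ↔ H.FG := by
  refine ⟨fun h => ?_, fg_map f⟩
  rw [Subgroup.fg_iff_submonoid_fg] at h ⊢
  exact h.map_injective f hf

theorem fg_inf_of_finiteIndex {G : Type*} [Group G] (N : Subgroup G) [N.FiniteIndex]
    {H : Subgroup G} (hH : H.FG) : (N ⊓ H).FG := by
  have : Group.FG H := (Group.fg_iff_subgroup_fg H).2 hH
  rw [← Subgroup.subgroupOf_map_subtype, fg_map_iff_of_injective H.subtype_injective,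
    ← Group.fg_iff_subgroup_fg]
  infer_instance

theorem fg_comap_of_injective {G N : Type*} [Group G] [Group N] {f : N →* G}
    (hf : Function.Injective f) [f.range.FiniteIndex] {H : Subgroup G} (hH : H.FG) :
    (H.comap f).FG := by
  rw [← fg_map_iff_of_injective hf, Subgroup.map_comap_eq]
  exact fg_inf_of_finiteIndex _ hH

theorem topFG_of_subset_closure {G : Type*} [Group G] [TopologicalSpace G] {H K : Subgroup G}
    (hH : H.FG) (hHK : H ≤ K) (hK : (K : Set G) ⊆ closure H) : TopFG K := by
  have hmap : (H.subgroupOf K).map K.subtype = H := Subgroup.map_subgroupOf_eq_of_le hHK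
  refine ⟨H.subgroupOf K, ?_, Subtype.dense_iff.2 ?_⟩
  · rwa [← fg_map_iff_of_injective K.subtype_injective, hmap]
  · rwa [← Subgroup.coe_subtype, ← Subgroup.coe_map, hmap]

variable {G N A : Type*} [Group G] [TopologicalSpace G] [Group N] [TopologicalSpace N] [Group A]

theorem TopFG.of_isOpenEmbedding {f : N →* G} (hf : Topology.IsOpenEmbedding f)
    [f.range.FiniteIndex] : TopFG G → TopFG N := fun ⟨H, hH, hdense⟩ =>
  ⟨H.comap f, fg_comap_of_injective hf.injective hH, hdense.preimage hf.isOpenMap⟩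

theorem TopFG.of_finiteIndex_range [IsTopologicalGroup G] {f : N →* G} (hf : Continuous f)
    [f.range.FiniteIndex] : TopFG N → TopFG G := by
  rintro ⟨H, hH, hdense⟩
  have : Finite (G ⧸ f.range) := Subgroup.finite_quotient_of_finiteIndex
  let T : Set G := Set.range (Quotient.out : G ⧸ f.range → G)
  let K : Subgroup G := H.map f ⊔ Subgroup.closure T
  have hrange : f.range ≤ K.topologicalClosure := by
    rintro _ ⟨n, rfl⟩
    exact closure_mono (SetLike.coe_subset_coe.2 (le_sup_left : H.map f ≤ K))
      (image_closure_subset_closure_image hf ⟨n, hdense n, rfl⟩)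
  have hT : T ⊆ K.topologicalClosure := fun t ht =>
    K.le_topologicalClosure (Subgroup.mem_sup_right (Subgroup.subset_closure ht))
  refine ⟨K, (fg_map f hH).sup
    ((Subgroup.fg_iff _).2 ⟨T, rfl, Set.finite_range _⟩), fun g => ?_⟩
  obtain ⟨n, hn⟩ := QuotientGroup.mk_out_eq_mul f.range g
  rw [eq_mul_inv_of_mul_eq hn.symm]
  exact K.topologicalClosure.mul_mem (hT ⟨_, rfl⟩) (inv_mem (hrange n.2))

theorem TopFG.finite_setOf_isOpen_ker [ContinuousMul G] [Finite A] (h : TopFG G) :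
    {φ : G →* A | IsOpen (φ.ker : Set G)}.Finite := by
  obtain ⟨H, hH, hdense⟩ := h
  have : Group.FG H := (Group.fg_iff_subgroup_fg H).2 hH
  have : Finite (H →* A) := finite_monoidHom_of_fg H A
  refine Set.Finite.of_injOn (f := fun φ => φ.comp H.subtype) (Set.mapsTo_univ _ _) ?_
    Set.finite_univ
  intro φ hφ ψ hψ hφψ
  ext g
  obtain ⟨h, ⟨hhφ, hhψ⟩, hh⟩ := hdense.inter_open_nonempty
    ((g⁻¹ * ·) ⁻¹' (φ.ker ∩ ψ.ker)) ((hφ.inter hψ).preimage (continuous_const_mul _))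
    ⟨g, by simp⟩
  have hφg : φ g = φ h := by simpa [MonoidHom.mem_ker, inv_mul_eq_one] using hhφ
  have hψg : ψ g = ψ h := by simpa [MonoidHom.mem_ker, inv_mul_eq_one] using hhψ
  rw [hφg, hψg]
  exact DFunLike.congr_fun hφψ ⟨h, hh⟩

theorem not_topFG_of_antitone [ContinuousMul G] [Finite A] {U : ℕ → Subgroup G} (hU : Antitone U)
    (hUo : ∀ n, IsOpen (U n : Set G)) (φ : ℕ → G →* A) (hle : ∀ n, U (n + 1) ≤ (φ n).ker)
    (hnle : ∀ n, ¬ U n ≤ (φ n).ker) : ¬ TopFG G := fun h => by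
  have hφ : Function.Injective φ := .of_lt_imp_ne fun m n hmn heq =>
    hnle n (heq ▸ (hU (Nat.succ_le_of_lt hmn)).trans (hle m))
  exact Set.infinite_of_injective_forall_mem hφ
    (fun n => Subgroup.isOpen_mono (hle n) (hUo (n + 1))) h.finite_setOf_isOpen_ker

end FiniteGeneration

section Commutator

open scoped commutatorElement

variable {G : Type*} [Group G] {c g h : G}

theorem commutatorElement_mul_left_of_commute (hg : Commute c g) (hh : Commute c h) :
    ⁅c * g, h⁆ = ⁅g, h⁆ := by
  have hgh : Commute c ⁅g, h⁆ :=
    ((hg.mul_right hh).mul_right hg.inv_right).mul_right hh.inv_right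
  rw [commutatorElement_mul_left_eq_conj_mul, hh.commutator_eq, mul_one,
    hgh.eq, mul_inv_cancel_right]

theorem commutatorElement_mul_right_of_commute (hg : Commute c g) (hh : Commute c h) :
    ⁅g, c * h⁆ = ⁅g, h⁆ := by
  rw [← commutatorElement_inv, commutatorElement_mul_left_of_commute hh hg, commutatorElement_inv]

end Commutator

namespace AutT

variable {d : ℕ}

theorem ext_apply {g h : AutT d} (H : ∀ v, g.1 v = h.1 v) : g = h :=
  Subtype.ext (RelIso.ext H)

theorem ext_label {g h : AutT d} (H : ∀ v, label g v = label h v) : g = h :=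
  ext_apply fun v => by
    induction v using List.reverseRecOn with
    | nil => rw [root, root]
    | append_singleton u x ih => rw [label_spec, label_spec, ih, H]

/-- The map of words determined by prescribed labels: it sends the word `x₁ x₂ x₃ …` to
`f [] x₁, f [x₁] x₂, f [x₁, x₂] x₃, …`. It underlies the automorphism `ofLabels f`. -/
def labelAct : (List (Fin d) → Equiv.Perm (Fin d)) → List (Fin d) → List (Fin d)
  | _, [] => []
  | f, x :: v => f [] x :: labelAct (fun w => f (x :: w)) v

section LabelAct

variable (f : List (Fin d) → Equiv.Perm (Fin d))

theorem labelAct_append_singleton (v : List (Fin d)) (x : Fin d) :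
    labelAct f (v ++ [x]) = labelAct f v ++ [f v x] := by
  induction v generalizing f with
  | nil => rfl
  | cons y v ih => simp [labelAct, ih]

theorem labelAct_injective : Function.Injective (labelAct f) := by
  intro v w h
  induction v generalizing f w with
  | nil => cases w with
    | nil => rfl
    | cons y w => simp [labelAct] at h
  | cons x v ih => cases w with
    | nil => simp [labelAct] at h
    | cons y w =>
      simp only [labelAct, List.cons.injEq, EmbeddingLike.apply_eq_iff_eq] at h
      obtain ⟨rfl, hvw⟩ := h
      rw [ih _ hvw]

theorem labelAct_surjective : Function.Surjective (labelAct f) := by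
  intro w
  induction w using List.reverseRecOn with
  | nil => exact ⟨[], rfl⟩
  | append_singleton w y ih =>
    obtain ⟨v, rfl⟩ := ih
    exact ⟨v ++ [(f v).symm y], by rw [labelAct_append_singleton, Equiv.apply_symm_apply]⟩

theorem exists_labelAct_eq_append_singleton_iff (v w : List (Fin d)) :
    (∃ y, labelAct f w = labelAct f v ++ [y]) ↔ ∃ x, w = v ++ [x] := by
  refine (f v).surjective.exists.trans (exists_congr fun x => ?_)
  rw [← labelAct_append_singleton, (labelAct_injective f).eq_iff]

/-- The automorphism of the tree whose label at each vertex `v` is the prescribed permutation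
`f v`. -/
noncomputable def ofLabels : AutT d :=
  ⟨{ Equiv.ofBijective (labelAct f) ⟨labelAct_injective f, labelAct_surjective f⟩ with
     map_rel_iff' := or_congr (exists_labelAct_eq_append_singleton_iff f _ _)
      (exists_labelAct_eq_append_singleton_iff f _ _) }, rfl⟩

@[simp] theorem label_ofLabels (v : List (Fin d)) : label (ofLabels f) v = f v :=
  label_eq _ _ _ (labelAct_append_singleton f v)

theorem ofLabels_cons (x : Fin d) (v : List (Fin d)) :
    (ofLabels f).1 (x :: v) = f [] x :: (ofLabels fun w => f (x :: w)).1 v := rfl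

@[simp] theorem ofLabels_label (g : AutT d) : ofLabels (label g) = g :=
  ext_label (label_ofLabels (label g))

end LabelAct

/-- The section of `g` at the letter `x`: the automorphism `g|_x` with
`g (x v) = g x (g|_x v)`. -/
noncomputable def sectionAt (g : AutT d) (x : Fin d) : AutT d :=
  ofLabels fun v => label g (x :: v)

theorem apply_cons (g : AutT d) (x : Fin d) (v : List (Fin d)) :
    g.1 (x :: v) = label g [] x :: (sectionAt g x).1 v := by
  rw [sectionAt, ← ofLabels_cons, ofLabels_label]

/-- The automorphism with trivial label at the root and prescribed sections, as a homomorphism;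
it embeds `Aut(T)ᵈ` as the stabilizer of the first level. -/
noncomputable def ofSections : (Fin d → AutT d) →* AutT d :=
  MonoidHom.mk' (fun g => ofLabels fun | [] => 1 | x :: v => label (g x) v) fun g h =>
    ext_apply fun v => by
      cases v with
      | nil => rfl
      | cons x v => simp [ofLabels_cons]

@[simp] theorem ofSections_cons (g : Fin d → AutT d) (x : Fin d) (v : List (Fin d)) :
    (ofSections g).1 (x :: v) = x :: (g x).1 v := by
  conv_rhs => rw [← ofLabels_label (g x)]
  rfl

@[simp] theorem label_ofSections_nil (g : Fin d → AutT d) : label (ofSections g) [] = 1 :=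
  label_ofLabels _ _

@[simp] theorem label_ofSections_cons (g : Fin d → AutT d) (x : Fin d) (v : List (Fin d)) :
    label (ofSections g) (x :: v) = label (g x) v :=
  label_ofLabels _ _

/-- The rooted automorphism of a permutation of the letters: it acts on the first letter of a word
and leaves the others unchanged. -/
noncomputable def rooted : Equiv.Perm (Fin d) →* AutT d :=
  MonoidHom.mk' (fun q => ofLabels fun v => if v = [] then q else 1) fun p q =>
    ext_label fun v => by
      cases v with
      | nil => simp [label_mul, root]
      | cons x v => simp [label_mul, ofLabels_cons]

@[simp] theorem label_rooted (q : Equiv.Perm (Fin d)) (v : List (Fin d)) :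
    label (rooted q) v = if v = [] then q else 1 := label_ofLabels _ _

@[simp] theorem rooted_cons (q : Equiv.Perm (Fin d)) (x : Fin d) (v : List (Fin d)) :
    (rooted q).1 (x :: v) = q x :: v := by
  have hsection : sectionAt (rooted q) x = 1 :=
    ext_label fun v => by simp [sectionAt, label_one]
  rw [apply_cons, hsection]
  simp

theorem eq_rooted_mul_ofSections (g : AutT d) :
    g = rooted (label g []) * ofSections (sectionAt g) :=
  ext_apply fun v => by
    cases v with
    | nil => rw [root, root]
    | cons x v => rw [mul_app, ofSections_cons, rooted_cons, apply_cons]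

theorem rooted_conj_ofSections (q : Equiv.Perm (Fin d)) (g : Fin d → AutT d) :
    rooted q * ofSections g * (rooted q)⁻¹ = ofSections fun x => g (q⁻¹ x) := by
  rw [← map_inv]
  refine ext_apply fun v => ?_
  cases v with
  | nil => rw [root, root]
  | cons x v =>
    rw [mul_app, mul_app, rooted_cons, ofSections_cons, rooted_cons, ofSections_cons]
    simp

/-- The automorphism with section `g` at the letter `x` that fixes all words not starting
with `x`. -/
noncomputable def below (x : Fin d) : AutT d →* AutT d :=
  ofSections.comp (MonoidHom.mulSingle (fun _ => AutT d) x)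

theorem below_apply (x : Fin d) (g : AutT d) : below x g = ofSections (Pi.mulSingle x g) := rfl

@[simp] theorem label_below_nil (x : Fin d) (g : AutT d) : label (below x g) [] = 1 :=
  label_ofSections_nil _

@[simp] theorem label_below_cons (x y : Fin d) (g : AutT d) (v : List (Fin d)) :
    label (below x g) (y :: v) = if y = x then label g v else 1 := by
  rw [below_apply, label_ofSections_cons, Pi.mulSingle_apply]
  split_ifs
  exacts [rfl, label_one v]

theorem label_below_mul_below_cons {x y : Fin d} (hxy : x ≠ y) (g h : AutT d) (z : Fin d)
    (v : List (Fin d)) : label (below x g * below y h) (z :: v) =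
      if z = x then label g v else if z = y then label h v else 1 := by
  rw [below_apply, below_apply, ← map_mul, label_ofSections_cons, Pi.mul_apply,
    Pi.mulSingle_apply, Pi.mulSingle_apply]
  split_ifs with hx hy
  · exact absurd (hx.symm.trans hy) hxy
  · rw [mul_one]
  · rw [one_mul]
  · rw [one_mul, label_one]

theorem commute_below {x y : Fin d} (hxy : x ≠ y) (g h : AutT d) :
    Commute (below x g) (below y h) :=
  (Pi.mulSingle_commute (f := fun _ => AutT d) hxy g h).map ofSections

theorem rooted_conj_below (q : Equiv.Perm (Fin d)) (x : Fin d) (g : AutT d) :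
    rooted q * below x g * (rooted q)⁻¹ = below (q x) g := by
  rw [below_apply, rooted_conj_ofSections, below_apply]
  congr 1
  funext y
  simp only [Pi.mulSingle_apply, Equiv.Perm.inv_eq_iff_eq]

theorem mem_levelStab_iff_label {n : ℕ} {g : AutT d} :
    g ∈ levelStab d n ↔ ∀ v : List (Fin d), v.length < n → label g v = 1 := by
  refine ⟨fun hg v hv => label_eq _ _ _ fun x => ?_, fun hg v hv => ?_⟩
  · have hv' : g ∈ levelStab d v.length := levelStab_antitone d hv.le hg
    have hvx : g ∈ levelStab d (v ++ [x]).length := levelStab_antitone d (by simpa using hv) hg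
    rw [hvx _ rfl, hv' _ rfl, Equiv.Perm.one_apply]
  · induction v using List.reverseRecOn generalizing n with
    | nil => exact root g
    | append_singleton u x ih =>
      have hu : u.length < n := by simp [← hv]
      rw [label_spec, hg u hu, ih (fun w hw => hg w (hw.trans hu)) rfl, Equiv.Perm.one_apply]

theorem ofSections_mem_levelStab {n : ℕ} {g : Fin d → AutT d} (hg : ∀ x, g x ∈ levelStab d n) :
    ofSections g ∈ levelStab d (n + 1) := by
  rintro (_ | ⟨x, v⟩) hv
  · exact root _
  · rw [ofSections_cons, hg x v (by simpa using hv)]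

theorem isOpen_levelStab (n : ℕ) : IsOpen (levelStab d n : Set (AutT d)) :=
  Subgroup.isOpen_of_mem_nhds _ ((levelBasis d).mem_nhds_one ⟨n, rfl⟩)

theorem mem_closure_of_forall_levelStab {s : Set (AutT d)} {g : AutT d}
    (h : ∀ n, ∃ k ∈ s, g⁻¹ * k ∈ levelStab d n) : g ∈ closure s := by
  refine (mem_closure_iff_nhds_basis ((levelBasis d).nhds_hasBasis g)).2 ?_
  rintro _ ⟨n, rfl⟩
  obtain ⟨k, hk, hgk⟩ := h n
  exact ⟨k, hk, _, hgk, mul_inv_cancel_left g k⟩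

/-- The infinitely iterated permutational wreath product of `Q`: the automorphisms all of whose
labels lie in `Q`. It is the group `G_Q^Q` of the family `G_Q^P`. -/
def iteratedWreath (Q : Subgroup (Equiv.Perm (Fin d))) : Subgroup (AutT d) where
  carrier := {g | ∀ v, label g v ∈ Q}
  one_mem' := fun v => by rw [label_one]; exact Q.one_mem
  mul_mem' := fun hg hh v => by rw [label_mul]; exact Q.mul_mem (hg _) (hh _)
  inv_mem' := fun hg v => by rw [label_inv]; exact Q.inv_mem (hg _)

section IteratedWreath

variable {Q P : Subgroup (Equiv.Perm (Fin d))}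

theorem rooted_mem_iteratedWreath {q : Equiv.Perm (Fin d)} (hq : q ∈ Q) :
    rooted q ∈ iteratedWreath Q := fun v => by
  rw [label_rooted]
  split_ifs
  exacts [hq, Q.one_mem]

theorem below_mem_iteratedWreath (x : Fin d) {g : AutT d} (hg : g ∈ iteratedWreath Q) :
    below x g ∈ iteratedWreath Q := by
  rintro (_ | ⟨y, v⟩)
  · rw [label_below_nil]
    exact Q.one_mem
  · rw [label_below_cons]
    split_ifs
    exacts [hg v, Q.one_mem]

theorem sectionAt_mem_iteratedWreath {g : AutT d} (hg : g ∈ iteratedWreath Q) (x : Fin d) :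
    sectionAt g x ∈ iteratedWreath Q := fun v => by
  rw [sectionAt, label_ofLabels]
  exact hg _

theorem iteratedWreath_le_GQP (hQP : Q ≤ P) (hN : (Q.subgroupOf P).Normal) :
    iteratedWreath Q ≤ GQP Q P hN := fun _ hg =>
  ⟨fun v => hQP (hg v), fun v w => Q.mul_mem (hg v) (Q.inv_mem (hg w))⟩

/-- The label at the root, as a homomorphism. Its kernel is the stabilizer of the first level. -/
noncomputable def rootLabel : AutT d →* Equiv.Perm (Fin d) :=
  MonoidHom.mk' (fun g => label g []) fun g h => by rw [label_mul, root]

theorem iteratedWreath_subgroupOf_GQP (hN : (Q.subgroupOf P).Normal) :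
    (iteratedWreath Q).subgroupOf (GQP Q P hN) =
      Q.comap (rootLabel.comp (GQP Q P hN).subtype) := by
  ext ⟨g, hg⟩
  exact ⟨fun h => h [], fun (h : label g [] ∈ Q) v => by simpa using Q.mul_mem (hg.2 v []) h⟩

theorem finiteIndex_iteratedWreath_subgroupOf_GQP (hN : (Q.subgroupOf P).Normal) :
    ((iteratedWreath Q).subgroupOf (GQP Q P hN)).FiniteIndex := by
  refine ⟨?_⟩
  rw [iteratedWreath_subgroupOf_GQP, Subgroup.index_comap]
  exact Subgroup.FiniteIndex.index_ne_zero

theorem isOpen_iteratedWreath_subgroupOf_GQP (hN : (Q.subgroupOf P).Normal) :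
    IsOpen ((iteratedWreath Q).subgroupOf (GQP Q P hN) : Set (GQP Q P hN)) := by
  have hle : (levelStab d 1).subgroupOf (GQP Q P hN) ≤
      (iteratedWreath Q).subgroupOf (GQP Q P hN) := fun g hg => by
    have hroot : label g.1 [] = 1 := mem_levelStab_iff_label.1 hg [] Nat.one_pos
    rw [iteratedWreath_subgroupOf_GQP]
    exact (hroot ▸ Q.one_mem : label g.1 [] ∈ Q)
  exact Subgroup.isOpen_mono hle ((isOpen_levelStab 1).preimage continuous_subtype_val)

theorem topFG_GQP_iff (hQP : Q ≤ P) (hN : (Q.subgroupOf P).Normal) :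
    TopFG (GQP Q P hN) ↔ TopFG (iteratedWreath Q) := by
  have hle : iteratedWreath Q ≤ GQP Q P hN := iteratedWreath_le_GQP hQP hN
  have hrange : (Subgroup.inclusion hle).range = (iteratedWreath Q).subgroupOf (GQP Q P hN) :=
    Subgroup.inclusion_range hle
  have hopen : Topology.IsOpenEmbedding (Subgroup.inclusion hle) :=
    ⟨Topology.IsEmbedding.inclusion hle, by
      rw [← MonoidHom.coe_range, hrange]
      exact isOpen_iteratedWreath_subgroupOf_GQP hN⟩
  have : (Subgroup.inclusion hle).range.FiniteIndex :=
    hrange ▸ finiteIndex_iteratedWreath_subgroupOf_GQP hN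
  exact ⟨.of_isOpenEmbedding hopen, .of_finiteIndex_range hopen.continuous⟩

end IteratedWreath

section NotTopFG

variable {Q : Subgroup (Equiv.Perm (Fin d))}

/-- The label at `v` of an element of the iterated wreath product, as an element of `Q`. -/
noncomputable def labelIn (g : iteratedWreath Q) (v : List (Fin d)) : Q := ⟨label g.1 v, g.2 v⟩

theorem labelIn_mul (g h : iteratedWreath Q) (v : List (Fin d)) :
    labelIn (g * h) v = labelIn g (h.1.1 v) * labelIn h v :=
  Subtype.ext (label_mul _ _ _)

theorem labelIn_eq_one_of_mem_levelStab {n : ℕ} {g : iteratedWreath Q} (hg : g.1 ∈ levelStab d n)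
    {v : List (Fin d)} (hv : v.length < n) : labelIn g v = 1 :=
  Subtype.ext (mem_levelStab_iff_label.1 hg v hv)

/-- The element of the iterated wreath product with label `q` at the vertex `u` and trivial labels
elsewhere. -/
noncomputable def singleLabel (u : List (Fin d)) (q : Q) : iteratedWreath Q :=
  ⟨ofLabels fun v => if v = u then q else 1, fun v => by
    rw [label_ofLabels]
    split_ifs
    exacts [q.2, Q.one_mem]⟩

theorem labelIn_singleLabel (u v : List (Fin d)) (q : Q) :
    labelIn (singleLabel u q) v = if v = u then q else 1 :=
  Subtype.ext (by
    refine (label_ofLabels _ v).trans ?_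
    split_ifs <;> rfl)

theorem singleLabel_mem_levelStab (u : List (Fin d)) (q : Q) :
    (singleLabel u q).1 ∈ levelStab d u.length :=
  mem_levelStab_iff_label.2 fun v hv =>
    (label_ofLabels _ v).trans (if_neg fun h => hv.ne (congrArg List.length h))

theorem not_topFG_iteratedWreath_of_homs {A : Type*} [Group A] [Finite A]
    (φ : ℕ → iteratedWreath Q →* A)
    (htriv : ∀ n g, g.1 ∈ levelStab d (n + 1) → φ n g = 1)
    (hne : ∀ n, ∃ u : List (Fin d), u.length = n ∧ ∃ q : Q, φ n (singleLabel u q) ≠ 1) :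
    ¬ TopFG (iteratedWreath Q) := by
  refine not_topFG_of_antitone (U := fun n => (levelStab d n).subgroupOf (iteratedWreath Q))
    (fun m n hmn => Subgroup.comap_mono (levelStab_antitone d hmn))
    (fun n => (isOpen_levelStab n).preimage continuous_subtype_val) φ htriv fun n hle => ?_
  obtain ⟨u, rfl, q, hq⟩ := hne n
  exact hq (hle (singleLabel_mem_levelStab u q))

theorem apply_replicate {x : Fin d} (hx : ∀ q ∈ Q, q x = x) {g : AutT d}
    (hg : g ∈ iteratedWreath Q) (n : ℕ) : g.1 (List.replicate n x) = List.replicate n x := by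
  induction n with
  | zero => exact root g
  | succ n ih => rw [List.replicate_succ', label_spec, ih, hx _ (hg _)]

theorem not_topFG_iteratedWreath_of_fixed (hQ : Q ≠ ⊥) {x : Fin d} (hx : ∀ q ∈ Q, q x = x) :
    ¬ TopFG (iteratedWreath Q) := by
  obtain ⟨q, hq⟩ := Subgroup.ne_bot_iff_exists_ne_one.1 hQ
  let φ (n : ℕ) : iteratedWreath Q →* Q :=
    MonoidHom.mk' (fun g => labelIn g (List.replicate n x)) fun g h => by
      rw [labelIn_mul, apply_replicate hx h.2]
  refine not_topFG_iteratedWreath_of_homs φ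
    (fun n g hg => labelIn_eq_one_of_mem_levelStab hg (by simp))
    fun n => ⟨List.replicate n x, List.length_replicate, q, fun h => hq ?_⟩
  rwa [MonoidHom.mk'_apply, labelIn_singleLabel, if_pos rfl] at h

/-- The permutation of the level `n` induced by an automorphism. -/
def levelPerm (g : AutT d) (n : ℕ) : Equiv.Perm (List.Vector (Fin d) n) where
  toFun v := ⟨g.1 v.1, (length_app g _).trans v.2⟩
  invFun v := ⟨(g⁻¹).1 v.1, (length_app _ _).trans v.2⟩
  left_inv _ := Subtype.ext (inv_app_self g _)
  right_inv _ := Subtype.ext (app_inv_self g _)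

section Character

variable {A : Type*} [CommGroup A]

/-- The homomorphism multiplying the values of a character `χ` of `Q` on the labels at the
level `n`. -/
noncomputable def levelCharacter (χ : Q →* A) (n : ℕ) : iteratedWreath Q →* A :=
  MonoidHom.mk' (fun g => ∏ v : List.Vector (Fin d) n, χ (labelIn g v.toList)) fun g h => by
    simp only [labelIn_mul, map_mul, Finset.prod_mul_distrib]
    congr 1
    exact Equiv.prod_comp (levelPerm h.1 n) fun v : List.Vector (Fin d) n => χ (labelIn g v.toList)

theorem levelCharacter_apply (χ : Q →* A) (n : ℕ) (g : iteratedWreath Q) :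
    levelCharacter χ n g = ∏ v : List.Vector (Fin d) n, χ (labelIn g v.toList) := rfl

theorem levelCharacter_singleLabel (χ : Q →* A) {n : ℕ} (u : List.Vector (Fin d) n) (q : Q) :
    levelCharacter χ n (singleLabel u.toList q) = χ q := by
  simp only [levelCharacter_apply, labelIn_singleLabel, List.Vector.toList_injective.eq_iff]
  rw [Finset.prod_eq_single_of_mem u (Finset.mem_univ u), if_pos rfl]
  exact fun v _ hv => by rw [if_neg hv, map_one]

theorem not_topFG_iteratedWreath_of_character [Finite A] {χ : Q →* A} (hχ : χ ≠ 1) :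
    ¬ TopFG (iteratedWreath Q) := by
  obtain ⟨q, hq⟩ := DFunLike.ne_iff.1 hχ
  obtain ⟨x, -⟩ : ∃ x, q.1 x ≠ x := by
    by_contra! h
    have hq1 : q = 1 := Subtype.ext (Equiv.ext h)
    exact hq (by rw [hq1, map_one, map_one])
  refine not_topFG_iteratedWreath_of_homs (levelCharacter χ) (fun n g hg => ?_)
    fun n => ⟨(List.Vector.replicate n x).toList, List.Vector.toList_length _, q, ?_⟩
  · rw [levelCharacter_apply]
    refine Finset.prod_eq_one fun v _ => ?_
    rw [labelIn_eq_one_of_mem_levelStab hg (v.toList_length.trans_lt n.lt_succ_self), map_one]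
  · rwa [levelCharacter_singleLabel]

end Character

theorem not_topFG_iteratedWreath_of_not_perfect (hQ : Q ≠ ⁅Q, Q⁆) :
    ¬ TopFG (iteratedWreath Q) := by
  have : Finite (Abelianization Q) := .of_surjective _ QuotientGroup.mk_surjective
  refine not_topFG_iteratedWreath_of_character (χ := (Abelianization.of : Q →* _)) fun h => hQ ?_
  have hcomm : commutator Q = ⊤ := by rw [← Abelianization.ker_of, h, MonoidHom.ker_one]
  rw [← Subgroup.map_subtype_commutator, hcomm, ← MonoidHom.range_eq_map, Subgroup.range_subtype]

end NotTopFG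

section TopFG

open scoped commutatorElement

variable {Q : Subgroup (Equiv.Perm (Fin d))} {H : Subgroup (AutT d)}

theorem exists_mem_levelStab_of_below_mem (hroot : ∀ q ∈ Q, rooted q ∈ H)
    (hbelow : ∀ x, ∀ h ∈ H, below x h ∈ H) (n : ℕ) :
    ∀ g ∈ iteratedWreath Q, ∃ h ∈ H, g⁻¹ * h ∈ levelStab d n := by
  induction n with
  | zero =>
    refine fun g _ => ⟨1, H.one_mem, fun v hv => ?_⟩
    rw [List.length_eq_zero_iff.1 hv, root]
  | succ n ih =>
    intro g hg
    choose h hh hgh using fun x => ih (sectionAt g x) (sectionAt_mem_iteratedWreath hg x)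
    have hsections : ofSections h ∈ H :=
      Subgroup.pi_mem_of_mulSingle_mem (H := H.comap ofSections) h fun x => hbelow x _ (hh x)
    have hquotient :
        g⁻¹ * (rooted (label g []) * ofSections h) = ofSections ((sectionAt g)⁻¹ * h) := by
      rw [inv_mul_eq_iff_eq_mul, map_mul, map_inv]
      nth_rewrite 2 [eq_rooted_mul_ofSections g]
      group
    refine ⟨_, H.mul_mem (hroot _ (hg [])) hsections, ?_⟩
    rw [hquotient]
    exact ofSections_mem_levelStab hgh

theorem iteratedWreath_subset_closure (hroot : ∀ q ∈ Q, rooted q ∈ H)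
    (hbelow : ∀ x, ∀ h ∈ H, below x h ∈ H) :
    (iteratedWreath Q : Set (AutT d)) ⊆ closure H := fun g hg =>
  mem_closure_of_forall_levelStab fun n => exists_mem_levelStab_of_below_mem hroot hbelow n g hg

theorem below_mem_of_below_mem [MulAction.IsPretransitive Q (Fin d)]
    (hroot : ∀ q ∈ Q, rooted q ∈ H) {x : Fin d} {g : AutT d} (hg : below x g ∈ H) (y : Fin d) :
    below y g ∈ H := by
  obtain ⟨q, rfl⟩ := MulAction.exists_smul_eq Q x y
  have hconj := H.mul_mem (H.mul_mem (hroot q q.2) hg) (H.inv_mem (hroot q q.2))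
  rwa [rooted_conj_below] at hconj

theorem below_below_mem_of_below_below_mem [MulAction.IsPretransitive Q (Fin d)]
    (hroot : ∀ q ∈ Q, rooted q ∈ H) (hbelow : ∀ x, ∀ q ∈ Q, below x (rooted q) ∈ H)
    {x y : Fin d} {g : AutT d} (hg : below x (below y g) ∈ H) (z w : Fin d) :
    below z (below w g) ∈ H :=
  below_mem_of_below_mem hroot
    (below_mem_of_below_mem (H := H.comap (below x)) (hbelow x) hg w) z

/-- The labels of `spinal x₀ x₁ q`. -/
def spinalLabels (x₀ x₁ : Fin d) (q : Equiv.Perm (Fin d)) : List (Fin d) → Equiv.Perm (Fin d)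
  | x :: y :: v =>
    if x = x₀ ∧ y = x₀ then spinalLabels x₀ x₁ q v
    else if x = x₁ ∧ y = x₁ ∧ v = [] then q else 1
  | _ => 1

/-- The spinal automorphism with label `q` at the words `x₀²ⁿ x₁ x₁` and trivial labels elsewhere.
The exponents of `x₀` are even so that conjugation by a rooted automorphism acting below `x₀` can
make the parts below `x₀` of two spinal automorphisms disjoint. -/
noncomputable def spinal (x₀ x₁ : Fin d) (q : Equiv.Perm (Fin d)) : AutT d :=
  ofLabels (spinalLabels x₀ x₁ q)

theorem spinal_mem_iteratedWreath (x₀ x₁ : Fin d) {q : Equiv.Perm (Fin d)} (hq : q ∈ Q) :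
    spinal x₀ x₁ q ∈ iteratedWreath Q := fun v => by
  rw [spinal, label_ofLabels]
  fun_induction spinalLabels x₀ x₁ q v with
  | case1 _ _ _ _ ih => exact ih
  | case2 => exact hq
  | case3 | case4 => exact Q.one_mem

variable {x₀ x₁ : Fin d}

theorem spinal_eq_mul (hx : x₀ ≠ x₁) (q : Equiv.Perm (Fin d)) :
    spinal x₀ x₁ q =
      below x₀ (below x₀ (spinal x₀ x₁ q)) * below x₁ (below x₁ (rooted q)) := by
  refine ext_label fun v => ?_
  rcases v with _ | ⟨x, _ | ⟨y, v⟩⟩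
  · simp [spinal, spinalLabels, label_mul, root]
  · rw [label_below_mul_below_cons hx]
    simp [spinal, spinalLabels]
  · rw [label_below_mul_below_cons hx, label_below_cons, label_below_cons, label_rooted]
    simp only [spinal, spinalLabels, label_ofLabels]
    grind

theorem commutator_spinal (hx : x₀ ≠ x₁) {r : Equiv.Perm (Fin d)} (hr : r x₀ ≠ x₀)
    (p q : Equiv.Perm (Fin d)) :
    ⁅spinal x₀ x₁ p, below x₀ (rooted r) * spinal x₀ x₁ q * (below x₀ (rooted r))⁻¹⁆ =
      below x₁ (below x₁ (rooted ⁅p, q⁆)) := by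
  have hcomm (g h : AutT d) : Commute (below x₀ g) (below x₁ h) := commute_below hx g h
  have hconj : below x₀ (rooted r) * spinal x₀ x₁ q * (below x₀ (rooted r))⁻¹ =
      below x₀ (below (r x₀) (spinal x₀ x₁ q)) * below x₁ (below x₁ (rooted q)) := by
    nth_rewrite 1 [spinal_eq_mul hx q]
    rw [← mul_assoc, mul_assoc, ← (hcomm (rooted r) _).inv_left.eq, ← mul_assoc, ← map_inv,
      ← map_mul, ← map_mul, rooted_conj_below]
  have hdisjoint : Commute (below x₀ (below (r x₀) (spinal x₀ x₁ q)))
      (below x₀ (below x₀ (spinal x₀ x₁ p))) := (commute_below hr _ _).map (below x₀)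
  rw [hconj, spinal_eq_mul hx p,
    commutatorElement_mul_right_of_commute (hdisjoint.mul_right (hcomm _ _)) (hcomm _ _),
    commutatorElement_mul_left_of_commute (hcomm _ _) (hcomm _ _), map_commutatorElement,
    map_commutatorElement, map_commutatorElement]

/-- The rooted and spinal automorphisms with labels in `Q`. -/
def spinalSeeds (Q : Subgroup (Equiv.Perm (Fin d))) (x₀ x₁ : Fin d) : Set (AutT d) :=
  rooted '' Q ∪ spinal x₀ x₁ '' Q

theorem finite_spinalSeeds : (spinalSeeds Q x₀ x₁).Finite := by
  have hQ : (Q : Set (Equiv.Perm (Fin d))).Finite := Set.toFinite _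
  exact (hQ.image _).union (hQ.image _)

/-- The group generated by the rooted and spinal automorphisms with labels in `Q` and their copies
below the vertices of the first level. If `Q` is perfect and transitive, it is dense in the iterated
wreath product. -/
def spinalGroup (Q : Subgroup (Equiv.Perm (Fin d))) (x₀ x₁ : Fin d) : Subgroup (AutT d) :=
  Subgroup.closure (spinalSeeds Q x₀ x₁ ∪ ⋃ x, below x '' spinalSeeds Q x₀ x₁)

theorem spinalGroup_fg : (spinalGroup Q x₀ x₁).FG :=
  (Subgroup.fg_iff _).2 ⟨_, rfl,
    finite_spinalSeeds.union (Set.finite_iUnion fun x => finite_spinalSeeds.image (below x))⟩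

theorem rooted_mem_spinalGroup : ∀ q ∈ Q, rooted q ∈ spinalGroup Q x₀ x₁ := fun q hq =>
  Subgroup.subset_closure (.inl (.inl ⟨q, hq, rfl⟩))

theorem spinal_mem_spinalGroup : ∀ q ∈ Q, spinal x₀ x₁ q ∈ spinalGroup Q x₀ x₁ := fun q hq =>
  Subgroup.subset_closure (.inl (.inr ⟨q, hq, rfl⟩))

theorem below_mem_spinalGroup_of_mem_spinalSeeds (x : Fin d) {g : AutT d}
    (hg : g ∈ spinalSeeds Q x₀ x₁) : below x g ∈ spinalGroup Q x₀ x₁ :=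
  Subgroup.subset_closure (.inr (Set.mem_iUnion.2 ⟨x, g, hg, rfl⟩))

theorem below_rooted_mem_spinalGroup (x : Fin d) :
    ∀ q ∈ Q, below x (rooted q) ∈ spinalGroup Q x₀ x₁ := fun q hq =>
  below_mem_spinalGroup_of_mem_spinalSeeds x (.inl ⟨q, hq, rfl⟩)

theorem spinalGroup_le_iteratedWreath : spinalGroup Q x₀ x₁ ≤ iteratedWreath Q := by
  have hseeds : spinalSeeds Q x₀ x₁ ⊆ iteratedWreath Q := by
    rintro _ (⟨q, hq, rfl⟩ | ⟨q, hq, rfl⟩)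
    exacts [rooted_mem_iteratedWreath hq, spinal_mem_iteratedWreath x₀ x₁ hq]
  refine (Subgroup.closure_le _).2 (Set.union_subset hseeds (Set.iUnion_subset fun x => ?_))
  rintro _ ⟨g, hg, rfl⟩
  exact below_mem_iteratedWreath x (hseeds hg)

section Perfect

variable [MulAction.IsPretransitive Q (Fin d)] (hx : x₀ ≠ x₁) (hQ : Q = ⁅Q, Q⁆)
include hx hQ

theorem below_below_rooted_mem_spinalGroup (x y : Fin d) {q : Equiv.Perm (Fin d)} (hq : q ∈ Q) :
    below x (below y (rooted q)) ∈ spinalGroup Q x₀ x₁ := by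
  obtain ⟨r, hr⟩ := MulAction.exists_smul_eq Q x₀ x₁
  have hle : ⁅Q, Q⁆ ≤ (spinalGroup Q x₀ x₁).comap ((below x₁).comp ((below x₁).comp rooted)) := by
    refine Subgroup.commutator_le.2 fun p hp q hq => ?_
    have hbelow := below_rooted_mem_spinalGroup (x₀ := x₀) (x₁ := x₁) x₀ r r.2
    have hconj := mul_mem (mul_mem hbelow (spinal_mem_spinalGroup q hq)) (inv_mem hbelow)
    have hspinal := spinal_mem_spinalGroup (x₀ := x₀) (x₁ := x₁) p hp
    have hcomm := mul_mem (mul_mem (mul_mem hspinal hconj) (inv_mem hspinal)) (inv_mem hconj)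
    rwa [← commutatorElement_def, commutator_spinal hx (hr.trans_ne hx.symm)] at hcomm
  exact below_below_mem_of_below_below_mem rooted_mem_spinalGroup below_rooted_mem_spinalGroup
    (hle (hQ ▸ hq)) x y

theorem below_below_spinal_mem_spinalGroup (x y : Fin d) {q : Equiv.Perm (Fin d)} (hq : q ∈ Q) :
    below x (below y (spinal x₀ x₁ q)) ∈ spinalGroup Q x₀ x₁ := by
  have hmem := mul_mem (spinal_mem_spinalGroup q hq)
    (inv_mem (below_below_rooted_mem_spinalGroup hx hQ x₁ x₁ hq))
  rw [mul_inv_eq_of_eq_mul (spinal_eq_mul hx q)] at hmem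
  exact below_below_mem_of_below_below_mem rooted_mem_spinalGroup below_rooted_mem_spinalGroup
    hmem x y

theorem below_mem_spinalGroup (x : Fin d) :
    ∀ g ∈ spinalGroup Q x₀ x₁, below x g ∈ spinalGroup Q x₀ x₁ := by
  suffices hle : spinalGroup Q x₀ x₁ ≤ (spinalGroup Q x₀ x₁).comap (below x) from fun _ hg => hle hg
  refine (Subgroup.closure_le _).2 (Set.union_subset
    (fun g hg => below_mem_spinalGroup_of_mem_spinalSeeds x hg) (Set.iUnion_subset fun y => ?_))
  rintro _ ⟨_, ⟨q, hq, rfl⟩ | ⟨q, hq, rfl⟩, rfl⟩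
  exacts [below_below_rooted_mem_spinalGroup hx hQ x y hq,
    below_below_spinal_mem_spinalGroup hx hQ x y hq]

end Perfect

theorem topFG_iteratedWreath [MulAction.IsPretransitive Q (Fin d)] [Nontrivial (Fin d)]
    (hQ : Q = ⁅Q, Q⁆) : TopFG (iteratedWreath Q) := by
  obtain ⟨x₀, x₁, hx⟩ := exists_pair_ne (Fin d)
  exact topFG_of_subset_closure (spinalGroup_fg (x₀ := x₀) (x₁ := x₁)) spinalGroup_le_iteratedWreath
    (iteratedWreath_subset_closure rooted_mem_spinalGroup (below_mem_spinalGroup hx hQ))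

end TopFG

end AutT

theorem mainTheorem8 (d : ℕ) (hd : 2 ≤ d) (Q P : Subgroup (Equiv.Perm (Fin d)))
    (hQ : Q ≠ ⊥) (hQP : Q ≤ P) (hN : (Q.subgroupOf P).Normal) :
    ((Q ≠ ⁅Q, Q⁆ ∨ ∃ x : Fin d, ∀ q ∈ Q, q x = x) → ¬ TopFG (GQP Q P hN)) ∧
    (MulAction.IsPretransitive Q (Fin d) → (TopFG (GQP Q P hN) ↔ Q = ⁅Q, Q⁆)) := by
  have : Nontrivial (Fin d) := Fin.nontrivial_iff_two_le.2 hd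
  rw [AutT.topFG_GQP_iff hQP hN]
  refine ⟨?_, fun _ => ⟨?_, AutT.topFG_iteratedWreath⟩⟩
  · rintro (hnot_perfect | ⟨x, hx⟩)
    · exact AutT.not_topFG_iteratedWreath_of_not_perfect hnot_perfect
    · exact AutT.not_topFG_iteratedWreath_of_fixed hQ hx
  · exact Function.mtr AutT.not_topFG_iteratedWreath_of_not_perfect
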